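/- Let $k\ge 2$, and let $\left[{r \atop s}\right]$ denote the unsigned Stirling numbers of the first kind. The equation $$1-e^{-x}=\sum_{i=0}^{k-1}e^{-x}\frac{x^i}{i!}+\sum_{i=k}^{\infty}\sum_{j=0}^{k}e^{-x}\,\frac{x^i}{i!}\,\frac{\left[{i+1 \atop j}\right]}{(i+1)!}$$ has a unique positive solution $\zeta_k$. Let $n\ge 1$ and let $X_1,\dots,X_n$ be independent, identically distributed, non-negative random variables with a continuous distribution function. They are revealed one after another to a gambler who may irrevocably accept up to $k$ of them, each at the moment it is revealed, and whose reward $\mathrm{ALG}$ is the largest accepted value ($0$ if none is accepted). Consider the following algorithm. Choose $\tau$ such that $\sum_{i=1}^n \mathbb P(X_i\ge\tau)=\zeta_k$ (if $n<\zeta_k$, where this is impossible, choose $\tau$ such that the sum equals $n$, for example $\tau=0$); such a $\tau$ exists. For $i=1,\dots,n$: if $X_i>\tau$, accept $X_i$ and set $\tau\leftarrow X_i$; stop once $k$ values have been accepted. For every such choice of $\tau$ this algorithm is $(1-e^{-\zeta_k})$-competitive: $$\mathbb E[\mathrm{ALG}]\ \ge\ (1-e^{-\zeta_k})\;\mathbb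 E\bigl[\max_{1\le i\le n}X_i\bigr],$$ with expectations taken in $[0,\infty]$. In particular, for $k=2,3,4$ the ratio $1-e^{-\zeta_k}$ is at least $0.8520$, $0.9463$ and $0.9816$, respectively. -/

import Mathlib

open MeasureTheory ProbabilityTheory

namespace TopOneOfK

/-- The values accepted by the gambler who has `k` slots left and current threshold `τ`, when
the values of the list are revealed one after another: a value strictly above the current
threshold is accepted, consumes one slot and becomes the new threshold. -/
noncomputable def accepted : ℕ → ℝ → List ℝ → List ℝ
  | _, _, [] => []
  | 0, _, _ :: _ => []
  | k + 1, τ, x :: xs => if τ < x then x :: accepted k x xs else accepted (k + 1) τ xs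

/-- The reward in the Top-1-of-`k` problem: the highest accepted value (`0` if none). -/
noncomputable def reward (k : ℕ) (τ : ℝ) (values : List ℝ) : ℝ :=
  (accepted k τ values).foldr max 0

/-- `ζ` is a positive solution of
`1 - e^{-x} = ∑_{i<k} e^{-x} x^i / i! + ∑_{i≥k} ∑_{j≤k} e^{-x} (x^i / i!) [i+1, j] / (i+1)!`,
where `[r, s]` are the unsigned Stirling numbers of the first kind. The series over `i ≥ k` is
indexed by `m = i - k`; it converges absolutely for every `x`. -/
def IsZeta (k : ℕ) (x : ℝ) : Prop :=
  0 < x ∧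
    1 - Real.exp (-x) =
      ∑ i ∈ Finset.range k, Real.exp (-x) * (x ^ i / (i.factorial : ℝ)) +
      ∑' m : ℕ, ∑ j ∈ Finset.range (k + 1),
        Real.exp (-x) * (x ^ (m + k) / ((m + k).factorial : ℝ)) *
          ((Nat.stirlingFirst (m + k + 1) j : ℝ) / ((m + k + 1).factorial : ℝ))

variable {Ω : Type*} [MeasurableSpace Ω] {n : ℕ}

/-- `X 0, …, X (n-1)` are independent identically distributed non-negative random variables
whose common distribution has no point masses (equivalently, a continuous cdf). -/
structure IsContinuousIID (X : Fin n → Ω → ℝ) (μ : Measure Ω) : Prop where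
  measurable : ∀ i, Measurable (X i)
  indep : iIndepFun X μ
  ident : ∀ i j, IdentDistrib (X i) (X j) μ μ
  nonneg : ∀ i, ∀ᵐ ω ∂μ, 0 ≤ X i ω
  noPointMass : ∀ i, ∀ x : ℝ, μ {ω | X i ω = x} = 0

/-- The expected number of the `X i` that are at least `τ` is `ζ`. If `n < ζ`, so that no
threshold can have expected count `ζ`, the expected count has to be `n`, i.e. almost surely all
values are at least `τ` (for instance `τ = 0`). -/
def IsInitialThreshold (X : Fin n → Ω → ℝ) (μ : Measure Ω) (ζ τ : ℝ) : Prop :=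
  ∑ i, μ.real {ω | τ ≤ X i ω} = min ζ (n : ℝ)

/-- `E[ALG] ≥ c * E[max_i X i]` for the algorithm with `k` slots and initial threshold `τ` on the
values `X 0, …, X (n-1)`, revealed in this order. Expectations of these (almost surely)
non-negative quantities are taken in `[0, ∞]`, so that no integrability is needed. -/
def IsCompetitive (k : ℕ) (τ : ℝ) (X : Fin n → Ω → ℝ) (μ : Measure Ω) (c : ℝ) : Prop :=
  ENNReal.ofReal c * ∫⁻ ω, ENNReal.ofReal (⨆ i, X i ω) ∂μ ≤
    ∫⁻ ω, ENNReal.ofReal (reward k τ (List.ofFn fun i => X i ω)) ∂μ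

end TopOneOfK

/-! Expectations are compared level by level: it suffices that `P(reward > v) ≥ (1 - e^{-ζ}) P(max >
v)` for every `v`. Let `u` and `q` be the probabilities that one value exceeds `τ` and `v`. If `v <
τ`, the reward exceeds `v` as soon as some value exceeds `τ`, which has probability `1 - (1 - u)^n ≥
1 - e^{-ζ}`. If `τ ≤ v`, a value above `v` is accepted exactly when fewer than `k` records above `τ`
precede the first value above `v`. Summing over the position of that value gives `q ∑ (1 - q)^i
fewRecords i k y`, where `y` is the probability of exceeding `τ` conditionally on not exceeding `v`
(`successProb_eq`). Both factors decrease in `i`, so Chebyshev's sum inequality extracts `q ∑ (1 -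
q)^i = 1 - (1 - q)^n = P(max > v)` times the average of `fewRecords i k y` over `i < n`. That
average is at least its Poisson limit `poissonRecordSucc k (n * y)` by a concavity argument
(`mul_poissonRecordSucc_le_sum_fewRecords`). The Poisson limit is antitone and `n * y ≤ n * u ≤ ζ`,
so it is at least `poissonRecordSucc k ζ`. The equation defining `ζ` says precisely that this equals
`1 - e^{-ζ}`: `ζ` balances the two cases. -/

namespace TopOneOfK

/-! ### Record counts of random permutations. -/

/-- The probability that a uniformly random permutation of `r` values has at most `k` records
(left-to-right maxima). -/
noncomputable def recordProb (k r : ℕ) : ℝ :=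
  (∑ j ∈ Finset.range (k + 1), (Nat.stirlingFirst r j : ℝ)) / (r.factorial : ℝ)

lemma recordProb_nonneg (k r : ℕ) : 0 ≤ recordProb k r := by
  unfold recordProb; positivity

lemma recordProb_zero_right (k : ℕ) : recordProb k 0 = 1 := by
  simp [recordProb, Finset.sum_range_succ']

lemma recordProb_zero_succ (r : ℕ) : recordProb 0 (r + 1) = 0 := by
  simp [recordProb]

/-- The last of `r + 1` values is a record with probability `1 / (r + 1)`, independently of the
earlier records; this is the Stirling recurrence. -/
lemma recordProb_succ_succ (k r : ℕ) :
    (r + 1 : ℝ) * recordProb (k + 1) (r + 1) = r * recordProb (k + 1) r + recordProb k r := by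
  have h0 : (r : ℝ) * (Nat.stirlingFirst r 0 : ℝ) = 0 := by cases r <;> simp
  have h1 : ∑ j ∈ Finset.range (k + 1 + 1), (Nat.stirlingFirst (r + 1) j : ℝ) =
      r * ∑ j ∈ Finset.range (k + 1 + 1), (Nat.stirlingFirst r j : ℝ) +
        ∑ j ∈ Finset.range (k + 1), (Nat.stirlingFirst r j : ℝ) := by
    rw [Finset.sum_range_succ', Finset.sum_range_succ' _ (k + 1), mul_add, h0]
    simp only [Nat.stirlingFirst_succ_succ, Nat.cast_add, Nat.cast_mul, Finset.sum_add_distrib,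
      Finset.mul_sum]
    simp
  have hr : (r.factorial : ℝ) ≠ 0 := by positivity
  unfold recordProb
  rw [h1, Nat.factorial_succ]
  push_cast
  field_simp

lemma recordProb_le_succ_left (k r : ℕ) : recordProb k r ≤ recordProb (k + 1) r := by
  unfold recordProb
  rw [Finset.sum_range_succ _ (k + 1)]
  gcongr
  simp

lemma recordProb_succ_le (k r : ℕ) : recordProb k (r + 1) ≤ recordProb k r := by
  cases k with
  | zero => rw [recordProb_zero_succ]; exact recordProb_nonneg _ _
  | succ k =>
    have h := recordProb_succ_succ k r
    have h' := recordProb_le_succ_left k r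
    have hr : (0 : ℝ) < r + 1 := by positivity
    nlinarith

lemma recordProb_le_one (k r : ℕ) : recordProb k r ≤ 1 := by
  rw [← recordProb_zero_right k]
  exact antitone_nat_of_succ_le (recordProb_succ_le k) (Nat.zero_le r)

lemma recordProb_eq_one {k r : ℕ} (h : r ≤ k) : recordProb k r = 1 := by
  induction r generalizing k with
  | zero => exact recordProb_zero_right k
  | succ r ih =>
    obtain ⟨k, rfl⟩ : ∃ l, k = l + 1 := ⟨k - 1, by omega⟩
    have h1 := recordProb_succ_succ k r
    rw [ih (by omega), ih (by omega)] at h1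
    have hr : (0 : ℝ) < r + 1 := by positivity
    nlinarith

lemma recordProb_succ_lt_one (k : ℕ) : recordProb k (k + 1) < 1 := by
  induction k with
  | zero => simp [recordProb_zero_succ]
  | succ k ih =>
    have h1 := recordProb_succ_succ k (k + 1)
    rw [recordProb_eq_one le_rfl] at h1
    have hr : (0 : ℝ) < ((k + 1 : ℕ) : ℝ) + 1 := by positivity
    nlinarith

/-! ### Poisson means of bounded sequences. -/

/-- The exponential generating function of `a`. -/
noncomputable def expGen (a : ℕ → ℝ) (x : ℝ) : ℝ := ∑' i, x ^ i / (i.factorial : ℝ) * a i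

/-- The mean of `a N` for a Poisson variable `N` of parameter `x`. -/
noncomputable def poissonMean (a : ℕ → ℝ) (x : ℝ) : ℝ := Real.exp (-x) * expGen a x

lemma summable_expGen {a : ℕ → ℝ} {C : ℝ} (ha : ∀ i, |a i| ≤ C) (x : ℝ) :
    Summable fun i : ℕ => x ^ i / (i.factorial : ℝ) * a i := by
  refine Summable.of_norm_bounded ((Real.summable_pow_div_factorial |x|).mul_right C) fun i => ?_
  rw [Real.norm_eq_abs, abs_mul, abs_div, abs_pow, Nat.abs_cast]
  gcongr
  exact ha i

lemma hasDerivAt_expGen {a : ℕ → ℝ} {C : ℝ} (ha : ∀ i, |a i| ≤ C) (x : ℝ) :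
    HasDerivAt (expGen a) (expGen (fun i => a (i + 1)) x) x := by
  set R : ℝ := |x| + 1
  have hC : 0 ≤ C := (abs_nonneg _).trans (ha 0)
  have hg : ∀ (i : ℕ) (y : ℝ), HasDerivAt (fun y : ℝ => y ^ i / (i.factorial : ℝ) * a i)
      (i * y ^ (i - 1) / (i.factorial : ℝ) * a i) y := fun i y =>
    ((hasDerivAt_pow i y).div_const _).mul_const _
  have hsucc : ∀ (i : ℕ) (y : ℝ), ((i + 1 : ℕ) : ℝ) * y ^ (i + 1 - 1) / ((i + 1).factorial : ℝ) =
      y ^ i / (i.factorial : ℝ) := fun i y => by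
    have : (i.factorial : ℝ) ≠ 0 := by positivity
    rw [Nat.factorial_succ, Nat.add_sub_cancel]
    push_cast
    field_simp
  have hu : Summable fun i : ℕ => i * R ^ (i - 1) / (i.factorial : ℝ) * C := by
    rw [← summable_nat_add_iff 1]
    simp only [hsucc]
    exact (Real.summable_pow_div_factorial R).mul_right C
  have key := hasDerivAt_tsum_of_isPreconnected (t := Metric.ball (0 : ℝ) R) (y₀ := x) (y := x) hu
    Metric.isOpen_ball (convex_ball _ _).isPreconnected (fun i y _ => hg i y) (fun i y hy => by
      rw [mem_ball_zero_iff, Real.norm_eq_abs] at hy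
      rw [Real.norm_eq_abs, abs_mul, abs_div, abs_mul, abs_pow, Nat.abs_cast, Nat.abs_cast]
      gcongr
      exact ha i) (by simp [R]) (summable_expGen ha x) (by simp [R])
  refine HasDerivAt.congr_deriv (f := expGen a) key ?_
  have hs : Summable fun i : ℕ => i * x ^ (i - 1) / (i.factorial : ℝ) * a i := by
    rw [← summable_nat_add_iff 1]
    simp only [hsucc]
    exact summable_expGen (fun i => ha (i + 1)) x
  rw [hs.tsum_eq_zero_add]
  simp only [hsucc]
  simp [expGen]

lemma mul_expGen_succ {a : ℕ → ℝ} {C : ℝ} (ha : ∀ i, |a i| ≤ C) (x : ℝ) :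
    HasSum (fun i : ℕ => x ^ i / (i.factorial : ℝ) * (i * a i))
      (x * expGen (fun i => a (i + 1)) x) := by
  have h := (summable_expGen (fun i => ha (i + 1)) x).hasSum.mul_left x
  rw [← hasSum_nat_add_iff' 1]
  simp only [Finset.sum_range_one, Nat.cast_zero, zero_mul, mul_zero, sub_zero]
  refine h.congr_fun fun i => ?_
  have : (i.factorial : ℝ) ≠ 0 := by positivity
  rw [Nat.factorial_succ]
  push_cast
  field_simp
  ring

/-- Differentiating a Poisson mean takes forward differences of the sequence, so monotonicity passes
from the sequence to its mean. -/
lemma hasDerivAt_poissonMean {a : ℕ → ℝ} {C : ℝ} (ha : ∀ i, |a i| ≤ C) (x : ℝ) :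
    HasDerivAt (poissonMean a) (poissonMean (fun i => a (i + 1)) x - poissonMean a x) x := by
  refine HasDerivAt.congr_deriv (f := poissonMean a)
    (((hasDerivAt_neg x).exp).mul (hasDerivAt_expGen ha x)) ?_
  simp only [poissonMean]
  ring

lemma poissonMean_mono {a b : ℕ → ℝ} {C D : ℝ} (ha : ∀ i, |a i| ≤ C) (hb : ∀ i, |b i| ≤ D)
    (hab : ∀ i, a i ≤ b i) {x : ℝ} (hx : 0 ≤ x) : poissonMean a x ≤ poissonMean b x := by
  refine mul_le_mul_of_nonneg_left ?_ (Real.exp_pos _).le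
  exact (summable_expGen ha x).tsum_le_tsum
    (fun i => mul_le_mul_of_nonneg_left (hab i) (by positivity)) (summable_expGen hb x)

lemma continuous_poissonMean {a : ℕ → ℝ} {C : ℝ} (ha : ∀ i, |a i| ≤ C) :
    Continuous (poissonMean a) :=
  continuous_iff_continuousAt.2 fun x => (hasDerivAt_poissonMean ha x).continuousAt

lemma poissonMean_apply_zero (a : ℕ → ℝ) : poissonMean a 0 = a 0 := by
  rw [poissonMean, expGen, tsum_eq_single 0 fun i hi => by simp [hi]]
  simp

lemma antitoneOn_poissonMean {a : ℕ → ℝ} {C : ℝ} (ha : ∀ i, |a i| ≤ C)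
    (hanti : ∀ i, a (i + 1) ≤ a i) : AntitoneOn (poissonMean a) (Set.Ici 0) := by
  refine antitoneOn_of_deriv_nonpos (convex_Ici 0) (continuous_poissonMean ha).continuousOn
    (fun x _ => (hasDerivAt_poissonMean ha x).differentiableAt.differentiableWithinAt) ?_
  intro x hx
  rw [interior_Ici] at hx
  rw [(hasDerivAt_poissonMean ha x).deriv, sub_nonpos]
  exact poissonMean_mono (fun i => ha (i + 1)) ha hanti (le_of_lt hx)

lemma abs_recordProb_le (k r : ℕ) : |recordProb k r| ≤ 1 := by
  rw [abs_of_nonneg (recordProb_nonneg k r)]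
  exact recordProb_le_one k r

/-! ### Poissonized record counts and their differential equations. -/

/-- The probability that `N` values, with `N` Poisson of parameter `x`, have at most `k` records. -/
noncomputable def poissonRecord (k : ℕ) : ℝ → ℝ := poissonMean (recordProb k)

/-- The probability that `N + 1` values, with `N` Poisson of parameter `x`, have at most `k`
records. -/
noncomputable def poissonRecordSucc (k : ℕ) : ℝ → ℝ := poissonMean fun i => recordProb k (i + 1)

lemma continuous_poissonRecordSucc (k : ℕ) : Continuous (poissonRecordSucc k) :=
  continuous_poissonMean fun i => abs_recordProb_le k (i + 1)

lemma antitoneOn_poissonRecord (k : ℕ) : AntitoneOn (poissonRecord k) (Set.Ici 0) :=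
  antitoneOn_poissonMean (abs_recordProb_le k) (recordProb_succ_le k)

lemma antitoneOn_poissonRecordSucc (k : ℕ) : AntitoneOn (poissonRecordSucc k) (Set.Ici 0) :=
  antitoneOn_poissonMean (fun i => abs_recordProb_le k (i + 1))
    fun i => recordProb_succ_le k (i + 1)

lemma poissonRecordSucc_zero (x : ℝ) : poissonRecordSucc 0 x = 0 := by
  simp [poissonRecordSucc, poissonMean, expGen, recordProb_zero_succ]

lemma poissonRecordSucc_apply_zero (k : ℕ) : poissonRecordSucc (k + 1) 0 = 1 := by
  rw [poissonRecordSucc, poissonMean_apply_zero]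
  exact recordProb_eq_one (by omega)

lemma hasDerivAt_poissonRecord (k : ℕ) (x : ℝ) :
    HasDerivAt (poissonRecord k) (poissonRecordSucc k x - poissonRecord k x) x :=
  hasDerivAt_poissonMean (abs_recordProb_le k) x

/-- The recurrence `recordProb_succ_succ` read coefficientwise. The derivative is antitone, which
makes the function concave on `[0, ∞)`. -/
lemma hasDerivAt_mul_poissonRecordSucc (k : ℕ) (x : ℝ) :
    HasDerivAt (fun x => x * poissonRecordSucc (k + 1) x) (poissonRecord k x) x := by
  have hb : ∀ i, |recordProb (k + 1) (i + 1)| ≤ 1 := fun i => abs_recordProb_le _ _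
  refine HasDerivAt.congr_deriv (f := fun x => x * poissonRecordSucc (k + 1) x)
    ((hasDerivAt_id x).mul (hasDerivAt_poissonMean hb x)) ?_
  simp only [id, one_mul]
  have hsum := ((summable_expGen hb x).hasSum.add (mul_expGen_succ hb x)).sub
    (mul_expGen_succ (abs_recordProb_le (k + 1)) x)
  have hE : expGen (recordProb k) x = expGen (fun i => recordProb (k + 1) (i + 1)) x +
      x * expGen (fun i => recordProb (k + 1) (i + 1 + 1)) x -
      x * expGen (fun i => recordProb (k + 1) (i + 1)) x := by
    refine Eq.trans ?_ hsum.tsum_eq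
    refine tsum_congr fun i => ?_
    have h := recordProb_succ_succ k i
    linear_combination -(x ^ i / (i.factorial : ℝ)) * h
  simp only [poissonRecord, poissonRecordSucc, poissonMean, hE]
  ring

/-- Both sides have the same derivative and equal `1` at `0`. The right side has the shape of the
recursion for `fewRecords`. -/
lemma poissonRecord_eq (k : ℕ) (x : ℝ) :
    poissonRecord k x =
      1 - x * poissonRecordSucc (k + 1) x + ∫ s in (0 : ℝ)..x, poissonRecordSucc k s := by
  set d : ℝ → ℝ := fun x => poissonRecord k x -
    (1 - x * poissonRecordSucc (k + 1) x + ∫ s in (0 : ℝ)..x, poissonRecordSucc k s)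
  have hd : ∀ y, HasDerivAt d 0 y := fun y => by
    refine HasDerivAt.congr_deriv (f := d) ((hasDerivAt_poissonRecord k y).sub
      (((hasDerivAt_mul_poissonRecordSucc k y).const_sub 1).add
        (intervalIntegral.integral_hasDerivAt_right
          ((continuous_poissonRecordSucc k).intervalIntegrable 0 y)
          ((continuous_poissonRecordSucc k).stronglyMeasurableAtFilter _ _)
          (continuous_poissonRecordSucc k).continuousAt))) ?_
    ring
  have h0 : d 0 = 0 := by
    simp [d, poissonRecord, poissonMean_apply_zero, recordProb_zero_right]
  have := is_const_of_deriv_eq_zero (fun y => (hd y).differentiableAt) (fun y => (hd y).deriv) x 0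
  rw [h0] at this
  exact sub_eq_zero.1 this

/-! ### The equation for `ζ`. -/

lemma isZeta_iff {k : ℕ} {x : ℝ} :
    IsZeta k x ↔ 0 < x ∧ 1 - Real.exp (-x) = poissonRecordSucc k x := by
  have hs := (summable_expGen (fun i => abs_recordProb_le k (i + 1)) x).mul_left (Real.exp (-x))
  have h : poissonRecordSucc k x = ∑ i ∈ Finset.range k, Real.exp (-x) * (x ^ i / (i.factorial : ℝ)) +
      ∑' m : ℕ, ∑ j ∈ Finset.range (k + 1),
        Real.exp (-x) * (x ^ (m + k) / ((m + k).factorial : ℝ)) *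
          ((Nat.stirlingFirst (m + k + 1) j : ℝ) / ((m + k + 1).factorial : ℝ)) := by
    rw [poissonRecordSucc, poissonMean, expGen, ← tsum_mul_left, ← hs.sum_add_tsum_nat_add k]
    congr 1
    · refine Finset.sum_congr rfl fun i hi => ?_
      rw [recordProb_eq_one (by have := Finset.mem_range.1 hi; omega), mul_one]
    · refine tsum_congr fun m => ?_
      rw [recordProb, Finset.sum_div, Finset.mul_sum, Finset.mul_sum]
      exact Finset.sum_congr rfl fun j _ => by ring
  rw [IsZeta, h]

lemma existsUnique_isZeta {k : ℕ} (hk : 1 ≤ k) : ∃! x, IsZeta k x := by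
  have hb : ∀ i, |recordProb k (i + 1)| ≤ 1 := fun i => abs_recordProb_le _ _
  set δ : ℝ := 1 - recordProb k (k + 1)
  have hδ : 0 < δ := sub_pos.2 (recordProb_succ_lt_one k)
  set F : ℝ → ℝ := fun x => poissonRecordSucc k x - (1 - Real.exp (-x))
  have hF : Continuous F := by
    have := continuous_poissonRecordSucc k
    fun_prop
  have hlt : ∀ x y, 0 ≤ x → x < y → F y < F x := fun x y hx hxy => by
    have h1 := antitoneOn_poissonRecordSucc k (Set.mem_Ici.2 hx) (Set.mem_Ici.2 (hx.trans hxy.le))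
      hxy.le
    have h2 : Real.exp (-y) < Real.exp (-x) := Real.exp_lt_exp.2 (by linarith)
    simp only [F]
    linarith
  have hF0 : 0 < F 0 := by
    obtain ⟨l, rfl⟩ : ∃ l, k = l + 1 := ⟨k - 1, by omega⟩
    simp [F, poissonRecordSucc_apply_zero]
  -- Only the term `i = k` of the series is bounded by less than the exponential term, with deficit
  -- `δ`. It forces `F x₁ < 0` once `x₁ ^ k * δ > k!`, which this choice ensures since `x₁ ^ k ≥
  -- x₁`.
  set x₁ : ℝ := 1 + k.factorial / δ
  have hx₁ : 1 ≤ x₁ := le_add_of_nonneg_right (by positivity)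
  have hF1 : F x₁ < 0 := by
    have hle : expGen (fun i => recordProb k (i + 1)) x₁ ≤
        Real.exp x₁ - x₁ ^ k / (k.factorial : ℝ) * δ := by
      have h1 : HasSum (fun i : ℕ => x₁ ^ i / (i.factorial : ℝ)) (Real.exp x₁) := by
        rw [Real.exp_eq_exp_ℝ]
        exact NormedSpace.expSeries_div_hasSum_exp x₁
      have h2 := h1.sub (hasSum_ite_eq k (x₁ ^ k / (k.factorial : ℝ) * δ))
      refine hasSum_le (fun i => ?_) (summable_expGen hb x₁).hasSum h2
      have hp : 0 ≤ x₁ ^ i / (i.factorial : ℝ) := by positivity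
      split_ifs with hik
      · subst hik
        simp only [δ]
        linarith
      · have := mul_le_mul_of_nonneg_left (recordProb_le_one k (i + 1)) hp
        linarith
    have hbig : 1 < x₁ ^ k / (k.factorial : ℝ) * δ := by
      have h1 : x₁ ≤ x₁ ^ k := le_self_pow₀ hx₁ (by omega)
      have h2 : (k.factorial : ℝ) < x₁ * δ := by
        simp only [x₁]
        rw [add_mul, div_mul_cancel₀ _ hδ.ne']
        linarith
      rw [div_mul_eq_mul_div, one_lt_div (by positivity)]
      exact h2.trans_le (mul_le_mul_of_nonneg_right h1 hδ.le)
    have he : Real.exp (-x₁) * Real.exp x₁ = 1 := by rw [← Real.exp_add]; simp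
    have hpos := Real.exp_pos (-x₁)
    simp only [F, poissonRecordSucc, poissonMean]
    nlinarith [mul_le_mul_of_nonneg_left hle hpos.le, mul_lt_mul_of_pos_left hbig hpos]
  obtain ⟨z, hz, hFz⟩ := intermediate_value_Ioo' (by linarith : (0 : ℝ) ≤ x₁) hF.continuousOn
    (show (0 : ℝ) ∈ Set.Ioo (F x₁) (F 0) from ⟨hF1, hF0⟩)
  refine ⟨z, isZeta_iff.2 ⟨hz.1, (sub_eq_zero.1 hFz).symm⟩, fun y hy => ?_⟩
  obtain ⟨hy0, hy⟩ := isZeta_iff.1 hy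
  have hFy : F y = 0 := by simp [F, hy]
  rcases lt_trichotomy y z with h | h | h
  · have := hlt y z hy0.le h; linarith
  · exact h
  · have := hlt z y hz.1.le h; linarith

/-- A partial sum of the series at a lower bound `r` of `-log (1 - c)` bounds `1 - exp (-ζ)`. -/
lemma le_one_sub_exp_of_isZeta {k M : ℕ} {ζ c r : ℝ} (hζ : IsZeta k ζ) (hr : 0 ≤ r) (hc : c < 1)
    (hexp : Real.exp r * (1 - c) ≤ 1)
    (hsum : c ≤ (1 - c) * ∑ i ∈ Finset.range M, r ^ i / (i.factorial : ℝ) * recordProb k (i + 1)) :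
    c ≤ 1 - Real.exp (-ζ) := by
  obtain ⟨hζ0, hζ⟩ := isZeta_iff.1 hζ
  by_contra! hlt
  -- At `x` the left side of the equation is `c`. As the right side is antitone, `c ≤
  -- poissonRecordSucc k x` contradicts `ζ < x`. The factor `e^{-x} = 1 - c` is exact; only the
  -- series is estimated from `r ≤ x`.
  set x := -Real.log (1 - c)
  have hex : Real.exp (-x) = 1 - c := by simp [x, Real.exp_log (sub_pos.2 hc)]
  have hζx : ζ < x := by
    have : Real.exp (-x) < Real.exp (-ζ) := by rw [hex]; linarith
    linarith [Real.exp_lt_exp.1 this]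
  have hrx : r ≤ x := by
    rw [← hex, ← Real.exp_add] at hexp
    linarith [Real.exp_le_one_iff.1 hexp]
  have h1 := antitoneOn_poissonRecordSucc k (Set.mem_Ici.2 hζ0.le)
    (Set.mem_Ici.2 (hr.trans hrx)) hζx.le
  have h2 : ∑ i ∈ Finset.range M, r ^ i / (i.factorial : ℝ) * recordProb k (i + 1) ≤
      expGen (fun i => recordProb k (i + 1)) x := by
    refine le_trans (Finset.sum_le_sum fun i _ => ?_)
      ((summable_expGen (fun i => abs_recordProb_le k (i + 1)) x).sum_le_tsum _ fun i _ =>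
        mul_nonneg (by have := hr.trans hrx; positivity) (recordProb_nonneg _ _))
    have := recordProb_nonneg k (i + 1)
    gcongr
  have h3 : c ≤ poissonRecordSucc k x := by
    rw [poissonRecordSucc, poissonMean, hex]
    exact hsum.trans (mul_le_mul_of_nonneg_left h2 (sub_pos.2 hc).le)
  linarith

/-! ### Records above a threshold and their Poisson lower bound. -/

/-- The probability that `i` independent values, each exceeding the threshold with probability
`u`, contain fewer than `k` records above the threshold. -/
noncomputable def fewRecords : ℕ → ℕ → ℝ → ℝ
  | _, 0 => fun _ => 0
  | 0, _ + 1 => fun _ => 1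
  | i + 1, k + 1 => fun u => (1 - u) * fewRecords i (k + 1) u + ∫ s in (0 : ℝ)..u, fewRecords i k s

lemma fewRecords_zero_right (i : ℕ) : fewRecords i 0 = fun _ => 0 := by
  cases i <;> rfl

lemma fewRecords_zero_succ (k : ℕ) : fewRecords 0 (k + 1) = fun _ => 1 := rfl

/-- Conditioning on the first value: it misses the threshold, or becomes the new one. In the latter
case the new exceedance probability `s` is Lebesgue distributed on `[0, u]`. -/
lemma fewRecords_succ_succ (i k : ℕ) (u : ℝ) : fewRecords (i + 1) (k + 1) u =
    (1 - u) * fewRecords i (k + 1) u + ∫ s in (0 : ℝ)..u, fewRecords i k s := rfl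

lemma continuous_fewRecords (i k : ℕ) : Continuous (fewRecords i k) := by
  induction i generalizing k with
  | zero => cases k <;> exact continuous_const
  | succ i ih =>
    cases k with
    | zero => exact continuous_const
    | succ k =>
      have h1 := ih (k + 1)
      have h2 : Continuous fun u : ℝ => ∫ s in (0 : ℝ)..u, fewRecords i k s :=
        intervalIntegral.continuous_primitive (fun a b => (ih k).intervalIntegrable a b) 0
      exact ((continuous_const.sub continuous_id).mul h1).add h2

lemma fewRecords_succ_le (i k : ℕ) {u : ℝ} (hu : u ∈ Set.Icc (0 : ℝ) 1) :
    fewRecords (i + 1) k u ≤ fewRecords i k u := by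
  induction i generalizing k u with
  | zero =>
    cases k with
    | zero => simp [fewRecords_zero_right]
    | succ k =>
      rw [fewRecords_succ_succ]
      cases k with
      | zero => simpa [fewRecords_zero_right, fewRecords_zero_succ] using hu.1
      | succ k => simp [fewRecords_zero_succ]
  | succ i ih =>
    cases k with
    | zero => simp [fewRecords_zero_right]
    | succ k =>
      rw [fewRecords_succ_succ, fewRecords_succ_succ i]
      have h1 : 0 ≤ 1 - u := sub_nonneg.2 hu.2
      refine add_le_add (mul_le_mul_of_nonneg_left (ih (k + 1) hu) h1) ?_
      exact intervalIntegral.integral_mono_on hu.1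
        ((continuous_fewRecords _ _).intervalIntegrable _ _)
        ((continuous_fewRecords _ _).intervalIntegrable _ _)
        fun s hs => ih k ⟨hs.1, hs.2.trans hu.2⟩

/-- The Euler scheme for the concave function `t ↦ t * poissonRecordSucc k (t * u)` lies above
that function. -/
lemma mul_poissonRecordSucc_le_sum_fewRecords (n k : ℕ) {u : ℝ} (hu : u ∈ Set.Icc (0 : ℝ) 1) :
    n * poissonRecordSucc k (n * u) ≤ ∑ i ∈ Finset.range n, fewRecords i k u := by
  induction n generalizing k u with
  | zero => simp
  | succ n ih =>
    cases k with
    | zero => simp [fewRecords_zero_right, poissonRecordSucc_zero]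
    | succ k =>
      have hsum : ∑ i ∈ Finset.range (n + 1), fewRecords i (k + 1) u =
          1 + (1 - u) * ∑ i ∈ Finset.range n, fewRecords i (k + 1) u +
            ∫ s in (0 : ℝ)..u, ∑ i ∈ Finset.range n, fewRecords i k s := by
        rw [Finset.sum_range_succ', intervalIntegral.integral_finsetSum fun i _ =>
          (continuous_fewRecords i k).intervalIntegrable _ _]
        simp only [fewRecords_succ_succ, fewRecords_zero_succ, Finset.sum_add_distrib,
          Finset.mul_sum]
        ring
      have hcont : Continuous fun s : ℝ => (n : ℝ) * poissonRecordSucc k (n * s) :=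
        continuous_const.mul ((continuous_poissonRecordSucc k).comp (continuous_const.mul continuous_id))
      have hint : ∫ s in (0 : ℝ)..(n * u), poissonRecordSucc k s ≤
          ∫ s in (0 : ℝ)..u, ∑ i ∈ Finset.range n, fewRecords i k s := by
        have h := intervalIntegral.mul_integral_comp_mul_left (a := 0) (b := u)
          (f := poissonRecordSucc k) (n : ℝ)
        rw [mul_zero, ← intervalIntegral.integral_const_mul] at h
        rw [← h]
        exact intervalIntegral.integral_mono_on hu.1 (hcont.intervalIntegrable _ _)
          ((continuous_finsetSum _ fun i _ => continuous_fewRecords i k).intervalIntegrable _ _)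
          fun s hs => ih k ⟨hs.1, hs.2.trans hu.2⟩
      have hode := poissonRecord_eq k (n * u)
      -- A concave function lies below its tangent at `t = n`. Replacing the slope by means of
      -- `hode` yields the recursion `hsum` as an inequality.
      have hstep : ((n + 1 : ℕ) : ℝ) * poissonRecordSucc (k + 1) ((n + 1 : ℕ) * u) ≤
          n * poissonRecordSucc (k + 1) (n * u) + poissonRecord k (n * u) := by
        rcases hu.1.eq_or_lt with rfl | hu0
        · simp [poissonRecordSucc_apply_zero, poissonRecord, poissonMean_apply_zero,
            recordProb_zero_right]
        · have hnu : 0 ≤ (n : ℝ) * u := by positivity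
          have hle : (n : ℝ) * u ≤ (n + 1 : ℕ) * u := by push_cast; linarith
          have hd := hasDerivAt_mul_poissonRecordSucc k
          have hmvt := (convex_Ici ((n : ℝ) * u)).image_sub_le_mul_sub_of_deriv_le
            (f := fun x => x * poissonRecordSucc (k + 1) x) (C := poissonRecord k (n * u))
            (fun x _ => (hd x).continuousAt.continuousWithinAt)
            (fun x _ => (hd x).differentiableAt.differentiableWithinAt)
            (fun x hx => by
              have hx' : (n : ℝ) * u ≤ x := interior_subset hx
              rw [(hd x).deriv]
              exact antitoneOn_poissonRecord k (Set.mem_Ici.2 hnu)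
                (Set.mem_Ici.2 (hnu.trans hx')) hx')
            _ Set.self_mem_Ici _ (Set.mem_Ici.2 hle) hle
          refine le_of_mul_le_mul_left ?_ hu0
          push_cast at hmvt ⊢
          linarith
      have h1 : 0 ≤ 1 - u := sub_nonneg.2 hu.2
      have h2 := mul_le_mul_of_nonneg_left (ih (k + 1) hu) h1
      rw [hsum]
      nlinarith

/-! ### The probability of accepting a value above a level. -/

/-- The probability of accepting a value above `v` among `n` independent values, with `k` slots
and a threshold `τ ≤ v`, where `u` and `q` are the probabilities of exceeding `τ` and `v`. -/
noncomputable def successProb (q : ℝ) : ℕ → ℕ → ℝ → ℝ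
  | 0, _ => fun _ => 0
  | _ + 1, 0 => fun _ => 0
  | n + 1, k + 1 => fun u =>
    q + (1 - u) * successProb q n (k + 1) u + ∫ s in q..u, successProb q n k s

lemma successProb_zero_left (q : ℝ) (k : ℕ) : successProb q 0 k = fun _ => 0 := rfl

lemma successProb_zero_right (q : ℝ) (n : ℕ) : successProb q n 0 = fun _ => 0 := by
  cases n <;> rfl

/-- The three terms correspond to a first value above `v`, at most `τ`, and in between; in the last
case the new threshold has exceedance probability `s ∈ [q, u]`. -/
lemma successProb_succ_succ (q : ℝ) (n k : ℕ) (u : ℝ) : successProb q (n + 1) (k + 1) u =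
    q + (1 - u) * successProb q n (k + 1) u + ∫ s in q..u, successProb q n k s := rfl

lemma continuous_successProb (q : ℝ) (n k : ℕ) : Continuous (successProb q n k) := by
  induction n generalizing k with
  | zero => exact continuous_const
  | succ n ih =>
    cases k with
    | zero => exact continuous_const
    | succ k =>
      have h2 : Continuous fun u : ℝ => ∫ s in q..u, successProb q n k s :=
        intervalIntegral.continuous_primitive (fun a b => (ih k).intervalIntegrable a b) q
      exact (continuous_const.add ((continuous_const.sub continuous_id).mul (ih (k + 1)))).add h2

lemma successProb_nonneg {q : ℝ} (hq : 0 ≤ q) (n k : ℕ) {u : ℝ} (hu : u ∈ Set.Icc q 1) :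
    0 ≤ successProb q n k u := by
  induction n generalizing k u with
  | zero => exact le_rfl
  | succ n ih =>
    cases k with
    | zero => exact le_rfl
    | succ k =>
      rw [successProb_succ_succ]
      have h1 : 0 ≤ 1 - u := sub_nonneg.2 hu.2
      have h2 := ih (k + 1) hu
      have h3 : 0 ≤ ∫ s in q..u, successProb q n k s :=
        intervalIntegral.integral_nonneg hu.1 fun s hs => ih k ⟨hs.1, hs.2.trans hu.2⟩
      positivity

/-- The index `i` counts the values before the first one above `v`. Conditionally on being at most
`v`, each of them exceeds `τ` with probability `y`, and a slot must remain after their records. -/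
lemma successProb_eq (q : ℝ) (n k : ℕ) (y : ℝ) : successProb q n k (q + (1 - q) * y) =
    q * ∑ i ∈ Finset.range n, (1 - q) ^ i * fewRecords i k y := by
  induction n generalizing k y with
  | zero => simp [successProb_zero_left]
  | succ n ih =>
    cases k with
    | zero => simp [successProb_zero_right, fewRecords_zero_right]
    | succ k =>
      have hint : ∫ s in q..(q + (1 - q) * y), successProb q n k s =
          (1 - q) * (q * ∑ i ∈ Finset.range n, (1 - q) ^ i * ∫ s in (0 : ℝ)..y, fewRecords i k s) := by
        have h := intervalIntegral.mul_integral_comp_add_mul (a := 0) (b := y)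
          (f := successProb q n k) (1 - q) q
        rw [mul_zero, add_zero] at h
        rw [← h]
        simp only [ih]
        rw [intervalIntegral.integral_const_mul, intervalIntegral.integral_finsetSum fun i _ =>
          ((continuous_fewRecords i k).const_mul _).intervalIntegrable _ _]
        simp only [intervalIntegral.integral_const_mul]
      rw [successProb_succ_succ, hint, ih, Finset.sum_range_succ']
      simp only [fewRecords_succ_succ, fewRecords_zero_succ, mul_add, Finset.sum_add_distrib,
        Finset.mul_sum, pow_succ]
      have e : ∀ a b c d e f : ℝ, a = f → b = d → c = e → a + b + c = d + e + f := by
        intros; linarith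
      refine e _ _ _ _ _ _ (by simp) (Finset.sum_congr rfl fun i _ => by ring)
        (Finset.sum_congr rfl fun i _ => by ring)

lemma mul_poissonRecordSucc_le_successProb {q u : ℝ} (hq : 0 ≤ q) (hu : u ∈ Set.Icc q 1)
    (n k : ℕ) :
    (1 - (1 - q) ^ n) * poissonRecordSucc k (n * u) ≤ successProb q n k u := by
  have hq1 : q ≤ 1 := hu.1.trans hu.2
  have hu0 : 0 ≤ u := hq.trans hu.1
  rcases n.eq_zero_or_pos with rfl | hn
  · simp [successProb_zero_left]
  -- For `q = 1` the quotient is `0` by convention, and `u = 1` keeps `hy` true.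
  set y : ℝ := (u - q) / (1 - q)
  have hy : u = q + (1 - q) * y := by
    rcases hq1.eq_or_lt with rfl | h
    · simpa using le_antisymm hu.2 hu.1
    · have : 1 - q ≠ 0 := (sub_pos.2 h).ne'
      simp only [y]; field_simp; ring
  have hy0 : 0 ≤ y := div_nonneg (sub_nonneg.2 hu.1) (sub_nonneg.2 hq1)
  have hyu : y ≤ u := by
    rcases hq1.eq_or_lt with rfl | h
    · simpa [y] using hu0
    · rw [div_le_iff₀ (sub_pos.2 h)]
      nlinarith [hu.2]
  have hy1 : y ∈ Set.Icc (0 : ℝ) 1 := ⟨hy0, hyu.trans hu.2⟩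
  have hgeom : q * ∑ i ∈ Finset.range n, (1 - q) ^ i = 1 - (1 - q) ^ n := by
    have := mul_neg_geom_sum (1 - q) n
    simpa using this
  have hn' : (0 : ℝ) < n := by exact_mod_cast hn
  -- Chebyshev's sum inequality for two antitone sequences.
  have hcheb : (∑ i ∈ Finset.range n, (1 - q) ^ i) * ∑ i ∈ Finset.range n, fewRecords i k y ≤
      n * ∑ i ∈ Finset.range n, (1 - q) ^ i * fewRecords i k y := by
    have h1 : Antitone fun i : ℕ => (1 - q) ^ i :=
      pow_right_anti₀ (sub_nonneg.2 hq1) (by linarith)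
    have h2 : Antitone fun i : ℕ => fewRecords i k y :=
      antitone_nat_of_succ_le fun i => fewRecords_succ_le i k hy1
    simpa using ((h1.monovary h2).monovaryOn (Finset.range n : Set ℕ)).sum_mul_sum_le_card_mul_sum
  have hE := mul_poissonRecordSucc_le_sum_fewRecords n k hy1
  have hG : poissonRecordSucc k (n * u) ≤ poissonRecordSucc k (n * y) :=
    antitoneOn_poissonRecordSucc k (Set.mem_Ici.2 (by positivity)) (Set.mem_Ici.2 (by positivity))
      (mul_le_mul_of_nonneg_left hyu hn'.le)
  have hA : 0 ≤ 1 - (1 - q) ^ n :=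
    sub_nonneg.2 (pow_le_one₀ (sub_nonneg.2 hq1) (by linarith))
  have hS : n * ((1 - (1 - q) ^ n) * poissonRecordSucc k (n * u)) ≤ n * successProb q n k u := by
    rw [hy, successProb_eq, ← hy]
    calc n * ((1 - (1 - q) ^ n) * poissonRecordSucc k (n * u))
        = (1 - (1 - q) ^ n) * (n * poissonRecordSucc k (n * u)) := by ring
      _ ≤ (1 - (1 - q) ^ n) * ∑ i ∈ Finset.range n, fewRecords i k y :=
          mul_le_mul_of_nonneg_left ((mul_le_mul_of_nonneg_left hG hn'.le).trans hE) hA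
      _ = q * ((∑ i ∈ Finset.range n, (1 - q) ^ i) * ∑ i ∈ Finset.range n, fewRecords i k y) := by
          rw [← hgeom]; ring
      _ ≤ q * (n * ∑ i ∈ Finset.range n, (1 - q) ^ i * fewRecords i k y) :=
          mul_le_mul_of_nonneg_left hcheb hq
      _ = n * (q * ∑ i ∈ Finset.range n, (1 - q) ^ i * fewRecords i k y) := by ring
  exact le_of_mul_le_mul_left hS hn'

/-! ### The tail function of an atomless law. -/

section Tail

variable (ν : Measure ℝ) [IsProbabilityMeasure ν]

lemma antitone_real_Ioi : Antitone fun t : ℝ => ν.real (Set.Ioi t) :=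
  fun _ _ h => measureReal_mono (Set.Ioi_subset_Ioi h)

lemma real_Ioi_eq (t : ℝ) : ν.real (Set.Ioi t) = 1 - cdf ν t := by
  rw [cdf_eq_real, ← Set.compl_Iic, probReal_compl_eq_one_sub measurableSet_Iic]

lemma continuous_real_Ioi [NullSingletonClass ν] : Continuous fun t : ℝ => ν.real (Set.Ioi t) := by
  simp only [real_Ioi_eq]
  refine continuous_const.sub (continuous_iff_continuousAt.2 fun a => ?_)
  have h1 : Function.leftLim (cdf ν) a = cdf ν a := by
    have h := (cdf ν).measure_singleton a
    rw [measure_cdf, measure_singleton, eq_comm, ENNReal.ofReal_eq_zero, sub_nonpos] at h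
    exact le_antisymm ((cdf ν).mono.leftLim_le le_rfl) h
  exact (cdf ν).mono.continuousAt_iff_leftLim_eq_rightLim.2 (by rw [h1, (cdf ν).rightLim_eq])

lemma exists_real_Ioi_eq [NullSingletonClass ν] {t : ℝ} (ht : t ∈ Set.Ioo (0 : ℝ) 1) :
    ∃ x, ν.real (Set.Ioi x) = t := by
  have hbot : Filter.Tendsto (fun t : ℝ => ν.real (Set.Ioi t)) Filter.atBot (nhds 1) := by
    simp only [real_Ioi_eq]
    simpa using (tendsto_cdf_atBot ν).const_sub 1
  have htop : Filter.Tendsto (fun t : ℝ => ν.real (Set.Ioi t)) Filter.atTop (nhds 0) := by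
    simp only [real_Ioi_eq]
    simpa using (tendsto_cdf_atTop ν).const_sub 1
  obtain ⟨a, ha⟩ := (hbot.eventually (lt_mem_nhds ht.2)).exists
  obtain ⟨b, hb⟩ := (htop.eventually (gt_mem_nhds ht.1)).exists
  have := isPreconnected_univ.intermediate_value (Set.mem_univ b) (Set.mem_univ a)
    (continuous_real_Ioi ν).continuousOn ⟨hb.le, ha.le⟩
  obtain ⟨x, -, hx⟩ := this
  exact ⟨x, hx⟩

/-- The probability integral transform. -/
lemma map_real_Ioi [NullSingletonClass ν] :
    ν.map (fun t : ℝ => ν.real (Set.Ioi t)) = volume.restrict (Set.Icc (0 : ℝ) 1) := by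
  set G : ℝ → ℝ := fun t : ℝ => ν.real (Set.Ioi t)
  have hG : Measurable G := (continuous_real_Ioi ν).measurable
  have hanti : Antitone G := antitone_real_Ioi ν
  have hle : ∀ t ∈ Set.Ioo (0 : ℝ) 1, ENNReal.ofReal t ≤ ν {x | G x ≤ t} := fun t ht => by
    obtain ⟨x, hx⟩ := exists_real_Ioi_eq ν ht
    rw [← hx, ofReal_measureReal]
    exact measure_mono fun y hy => hanti (le_of_lt hy)
  have hge : ∀ t ∈ Set.Ioo (0 : ℝ) 1, ν {x | G x < t} ≤ ENNReal.ofReal t := fun t ht => by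
    obtain ⟨x, hx⟩ := exists_real_Ioi_eq ν ht
    rw [← hx, ofReal_measureReal]
    exact measure_mono fun y hy => lt_of_not_ge fun h => absurd (hanti h) (not_le.2 hy)
  have hge' : ∀ t, 0 ≤ t → t < 1 → ν {x | G x ≤ t} ≤ ENNReal.ofReal t := fun t h0 h1 => by
    have hlim : Filter.Tendsto (fun s => ENNReal.ofReal s) (nhdsWithin t (Set.Ioi t))
        (nhds (ENNReal.ofReal t)) :=
      (ENNReal.continuous_ofReal.tendsto t).mono_left nhdsWithin_le_nhds
    refine ge_of_tendsto hlim ?_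
    filter_upwards [Ioo_mem_nhdsGT h1] with s hs
    exact (measure_mono fun x (hx : G x ≤ t) => hx.trans_lt hs.1).trans
      (hge s ⟨h0.trans_lt hs.1, hs.2⟩)
  have : IsFiniteMeasure (ν.map G) := by
    have := Measure.isProbabilityMeasure_map (μ := ν) hG.aemeasurable
    infer_instance
  refine Measure.ext_of_Iic _ _ fun t => ?_
  rw [Measure.map_apply hG measurableSet_Iic, Measure.restrict_apply measurableSet_Iic]
  change ν {x | G x ≤ t} = _
  rcases lt_or_ge t 0 with h0 | h0
  · have h1 : {x | G x ≤ t} = ∅ :=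
      Set.eq_empty_of_forall_notMem fun x hx => absurd measureReal_nonneg (not_le.2 (hx.trans_lt h0))
    have h2 : Set.Iic t ∩ Set.Icc (0 : ℝ) 1 = ∅ :=
      Set.eq_empty_of_forall_notMem fun x hx => absurd (hx.2.1.trans hx.1) (not_le.2 h0)
    rw [h1, h2, measure_empty, measure_empty]
  rcases lt_or_ge t 1 with h1 | h1
  · have h2 : Set.Iic t ∩ Set.Icc (0 : ℝ) 1 = Set.Icc 0 t := by
      ext x; simp only [Set.mem_inter_iff, Set.mem_Iic, Set.mem_Icc]
      constructor
      · rintro ⟨a, b, c⟩; exact ⟨b, a⟩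
      · rintro ⟨a, b⟩; exact ⟨b, a, b.trans h1.le⟩
    rw [h2, Real.volume_Icc, sub_zero]
    refine le_antisymm (hge' t h0 h1) ?_
    rcases h0.eq_or_lt with rfl | h0
    · simp
    · exact hle t ⟨h0, h1⟩
  · have h2 : Set.Iic t ∩ Set.Icc (0 : ℝ) 1 = Set.Icc 0 1 :=
      Set.inter_eq_right.2 fun x hx => hx.2.trans h1
    have h3 : {x | G x ≤ t} = Set.univ := Set.eq_univ_of_forall fun x => measureReal_le_one.trans h1
    rw [h2, h3, Real.volume_Icc, measure_univ]
    simp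

/-- A change of variables along the probability integral transform. -/
lemma setLIntegral_Ioo_le [NullSingletonClass ν] {f : ℝ → ENNReal} (hf : Measurable f) (τ v : ℝ) :
    ∫⁻ s in Set.Ioo (ν.real (Set.Ioi v)) (ν.real (Set.Ioi τ)), f s ≤
      ∫⁻ x in Set.Ioc τ v, f (ν.real (Set.Ioi x)) ∂ν := by
  have hG : Measurable fun t : ℝ => ν.real (Set.Ioi t) := (continuous_real_Ioi ν).measurable
  have hanti := antitone_real_Ioi ν
  have hsub : Set.Ioo (ν.real (Set.Ioi v)) (ν.real (Set.Ioi τ)) ⊆ Set.Icc 0 1 :=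
    fun s hs => ⟨measureReal_nonneg.trans hs.1.le, hs.2.le.trans measureReal_le_one⟩
  rw [← Set.inter_eq_left.2 hsub, ← Measure.restrict_restrict measurableSet_Ioo, ← map_real_Ioi ν,
    setLIntegral_map measurableSet_Ioo hf hG]
  -- The preimage of the open interval lies in `(τ, v]`. The inclusion can be strict, since the tail
  -- may be flat near the endpoints.
  refine lintegral_mono_set fun x hx => ⟨?_, ?_⟩
  · exact lt_of_not_ge fun h => absurd (hanti h) (not_le.2 hx.2)
  · exact le_of_lt (lt_of_not_ge fun h => absurd (hanti h) (not_le.2 hx.1))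

end Tail

/-! ### The reward on independent values. -/

lemma reward_nil (k : ℕ) (τ : ℝ) : reward k τ [] = 0 := by simp [reward, accepted]

lemma reward_zero (τ : ℝ) (l : List ℝ) : reward 0 τ l = 0 := by
  cases l <;> simp [reward, accepted]

lemma reward_succ_cons (k : ℕ) (τ x : ℝ) (l : List ℝ) :
    reward (k + 1) τ (x :: l) = if τ < x then max x (reward k x l) else reward (k + 1) τ l := by
  simp only [reward, accepted]
  split_ifs <;> rfl

lemma measurable_reward (n k : ℕ) :
    Measurable fun p : ℝ × (Fin n → ℝ) => reward k p.1 (List.ofFn p.2) := by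
  induction n generalizing k with
  | zero => simp [reward_nil]
  | succ n ih =>
    cases k with
    | zero => simp [reward_zero]
    | succ k =>
      have hx : Measurable fun p : ℝ × (Fin (n + 1) → ℝ) => p.2 0 := by fun_prop
      have ht : Measurable fun p : ℝ × (Fin (n + 1) → ℝ) => fun i : Fin n => p.2 i.succ := by
        fun_prop
      simp only [List.ofFn_succ, reward_succ_cons]
      exact Measurable.ite (measurableSet_lt measurable_fst hx)
        (hx.max ((ih k).comp (hx.prodMk ht))) ((ih (k + 1)).comp (measurable_fst.prodMk ht))

/-- The first value of a finite family of independent values can be integrated out. -/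
lemma lintegral_pi_succ (ν : Measure ℝ) [IsProbabilityMeasure ν] {n : ℕ}
    {s : Set (Fin (n + 1) → ℝ)} (hs : MeasurableSet s) :
    Measure.pi (fun _ : Fin (n + 1) => ν) s =
      ∫⁻ x, Measure.pi (fun _ : Fin n => ν) {y | Fin.cons x y ∈ s} ∂ν := by
  have h := (measurePreserving_piFinSuccAbove (fun _ : Fin (n + 1) => ν) 0).symm
  rw [← h.map_eq, Measure.map_apply h.measurable hs, Measure.prod_apply (h.measurable hs)]
  refine lintegral_congr fun x => congrArg _ (Set.ext fun y => ?_)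
  change Fin.insertNth 0 x y ∈ s ↔ Fin.cons x y ∈ s
  rw [Fin.insertNth_zero']

/-- The lower bound suffices. The first value is integrated out over `(v, ∞)`, `(-∞, τ]` and `(τ,
v]`, matching the three terms of `successProb_succ_succ`. -/
lemma ofReal_successProb_le {ν : Measure ℝ} [IsProbabilityMeasure ν] [NullSingletonClass ν] {τ v : ℝ}
    (hτ : τ ≤ v) (n k : ℕ) :
    ENNReal.ofReal (successProb (ν.real (Set.Ioi v)) n k (ν.real (Set.Ioi τ))) ≤
      Measure.pi (fun _ : Fin n => ν) {x | v < reward k τ (List.ofFn x)} := by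
  induction n generalizing k τ with
  | zero => simp [successProb_zero_left]
  | succ n ih =>
    cases k with
    | zero => simp [successProb_zero_right]
    | succ k =>
      have hmeas : MeasurableSet {x : Fin (n + 1) → ℝ | v < reward (k + 1) τ (List.ofFn x)} :=
        measurableSet_lt measurable_const
          ((measurable_reward (n + 1) (k + 1)).comp measurable_prodMk_left)
      set q := ν.real (Set.Ioi v)
      set u := ν.real (Set.Ioi τ)
      have hqu : q ≤ u := antitone_real_Ioi ν hτ
      have hu1 : u ≤ 1 := measureReal_le_one
      have hq0 : 0 ≤ q := measureReal_nonneg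
      rw [lintegral_pi_succ ν hmeas]
      simp only [Set.mem_ofPred_eq, List.ofFn_succ, Fin.cons_zero, Fin.cons_succ, reward_succ_cons]
      set F : ℝ → ENNReal := fun x => Measure.pi (fun _ : Fin n => ν)
        {y | v < if τ < x then max x (reward k x (List.ofFn y)) else
          reward (k + 1) τ (List.ofFn y)}
      change _ ≤ ∫⁻ x, F x ∂ν
      have h1 : ENNReal.ofReal q ≤ ∫⁻ x in Set.Ioi v, F x ∂ν := by
        rw [ofReal_measureReal, ← setLIntegral_one]
        refine setLIntegral_mono' measurableSet_Ioi fun x (hx : v < x) => ?_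
        simp [F, hτ.trans_lt hx, hx]
      have h2 : ENNReal.ofReal (∫ s in q..u, successProb q n k s) ≤
          ∫⁻ x in Set.Ioc τ v, F x ∂ν := by
        rw [intervalIntegral.integral_of_le hqu, integral_Ioc_eq_integral_Ioo,
          ofReal_integral_eq_lintegral_ofReal]
        · refine (setLIntegral_Ioo_le ν
            (continuous_successProb q n k).measurable.ennreal_ofReal τ v).trans ?_
          refine setLIntegral_mono' measurableSet_Ioc fun x hx => (ih hx.2 k).trans ?_
          refine measure_mono fun y (hy : v < _) => ?_
          simp [hx.1, hy]
        · exact ((continuous_successProb q n k).integrableOn_Icc).mono_set Set.Ioo_subset_Icc_self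
        · refine (ae_restrict_iff' measurableSet_Ioo).2 (ae_of_all _ fun s hs => ?_)
          exact successProb_nonneg hq0 n k ⟨hs.1.le, hs.2.le.trans hu1⟩
      have h3 : ENNReal.ofReal ((1 - u) * successProb q n (k + 1) u) ≤
          ∫⁻ x in Set.Iic τ, F x ∂ν := by
        have hI : ν (Set.Iic τ) = ENNReal.ofReal (1 - u) := by
          rw [← probReal_compl_eq_one_sub measurableSet_Ioi, Set.compl_Ioi, ofReal_measureReal]
        rw [ENNReal.ofReal_mul (sub_nonneg.2 hu1), ← hI, mul_comm, ← setLIntegral_const]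
        refine setLIntegral_mono' measurableSet_Iic fun x (hx : x ≤ τ) => (ih hτ (k + 1)).trans ?_
        simp [F, not_lt.2 hx]
      have hsplit : ∫⁻ x, F x ∂ν = ∫⁻ x in Set.Ioi v, F x ∂ν +
          (∫⁻ x in Set.Iic τ, F x ∂ν + ∫⁻ x in Set.Ioc τ v, F x ∂ν) := by
        rw [← lintegral_union measurableSet_Ioc (Set.Iic_disjoint_Ioc le_rfl),
          Set.Iic_union_Ioc_eq_Iic hτ, add_comm, ← Set.compl_Iic,
          lintegral_add_compl _ measurableSet_Iic]
      rw [hsplit, successProb_succ_succ, add_assoc]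
      exact ENNReal.ofReal_add_le.trans
        (add_le_add h1 (ENNReal.ofReal_add_le.trans (add_le_add h3 h2)))

/-! ### Comparison of reward and maximum at each level. -/

lemma reward_nonneg (k : ℕ) (τ : ℝ) (l : List ℝ) : 0 ≤ reward k τ l := by
  unfold reward
  induction accepted k τ l with
  | nil => exact le_rfl
  | cons a l ih => exact ih.trans (le_max_right _ _)

lemma lt_reward_of_exists_lt (k : ℕ) {τ : ℝ} {l : List ℝ} (h : ∃ x ∈ l, τ < x) :
    τ < reward (k + 1) τ l := by
  induction l with
  | nil => simp at h
  | cons x l ih =>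
    rw [reward_succ_cons]
    split_ifs with hx
    · exact lt_max_of_lt_left hx
    · obtain ⟨y, hy, hτy⟩ := h
      rcases List.mem_cons.1 hy with rfl | hy
      · exact absurd hτy hx
      · exact ih ⟨y, hy, hτy⟩

lemma lt_iSup_fin_iff {n : ℕ} [NeZero n] {v : ℝ} {x : Fin n → ℝ} :
    v < ⨆ i, x i ↔ ∃ i, v < x i :=
  lt_ciSup_iff (Set.finite_range x).bddAbove

lemma pi_lt_iSup (ν : Measure ℝ) [IsProbabilityMeasure ν] (n : ℕ) [NeZero n] (v : ℝ) :
    Measure.pi (fun _ : Fin n => ν) {x | v < ⨆ i, x i} =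
      ENNReal.ofReal (1 - (1 - ν.real (Set.Ioi v)) ^ n) := by
  have h : {x : Fin n → ℝ | v < ⨆ i, x i} = (Set.univ.pi fun _ => Set.Iic v)ᶜ := by
    ext x
    simp [lt_iSup_fin_iff, Pi.le_def]
  have hq : 0 ≤ 1 - ν.real (Set.Ioi v) := sub_nonneg.2 measureReal_le_one
  have hI : ν (Set.Iic v) = ENNReal.ofReal (1 - ν.real (Set.Ioi v)) := by
    rw [← probReal_compl_eq_one_sub measurableSet_Ioi, Set.compl_Ioi, ofReal_measureReal]
  rw [h, prob_compl_eq_one_sub (MeasurableSet.univ_pi fun _ => measurableSet_Iic), Measure.pi_pi,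
    Finset.prod_const, Finset.card_univ, Fintype.card_fin, hI, ← ENNReal.ofReal_pow hq,
    ENNReal.ofReal_sub _ (pow_nonneg hq n), ENNReal.ofReal_one]

/-- The competitive ratio holds for the probability of exceeding any level `v ≥ 0`. -/
lemma ofReal_mul_pi_lt_iSup_le {ν : Measure ℝ} [IsProbabilityMeasure ν] [NullSingletonClass ν]
    {k n : ℕ} [NeZero n] {ζ τ : ℝ} (hζ : IsZeta (k + 1) ζ)
    (hτ : n * ν.real (Set.Ioi τ) = min ζ n) (v : ℝ) :
    ENNReal.ofReal (1 - Real.exp (-ζ)) * Measure.pi (fun _ : Fin n => ν) {x | v < ⨆ i, x i} ≤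
      Measure.pi (fun _ : Fin n => ν) {x | v < reward (k + 1) τ (List.ofFn x)} := by
  obtain ⟨hζ0, hζ⟩ := isZeta_iff.1 hζ
  have hc : 0 ≤ 1 - Real.exp (-ζ) := sub_nonneg.2 (Real.exp_le_one_iff.2 (by linarith))
  rcases le_or_gt τ v with hv | hv
  · refine le_trans ?_ (ofReal_successProb_le hv n (k + 1))
    rw [pi_lt_iSup, ← ENNReal.ofReal_mul hc]
    refine ENNReal.ofReal_le_ofReal ?_
    have hq0 : 0 ≤ ν.real (Set.Ioi v) := measureReal_nonneg
    have hq1 : ν.real (Set.Ioi v) ≤ 1 := measureReal_le_one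
    refine le_trans ?_ (mul_poissonRecordSucc_le_successProb hq0
      ⟨antitone_real_Ioi ν hv, measureReal_le_one⟩ n (k + 1))
    rw [mul_comm, hζ, hτ]
    refine mul_le_mul_of_nonneg_left ?_
      (sub_nonneg.2 (pow_le_one₀ (sub_nonneg.2 hq1) (by linarith)))
    exact antitoneOn_poissonRecordSucc (k + 1) (Set.mem_Ici.2 (le_min hζ0.le n.cast_nonneg))
      (Set.mem_Ici.2 hζ0.le) (min_le_left _ _)
  · have hn : (0 : ℝ) < n := by exact_mod_cast Nat.pos_of_neZero n
    have hp1 : ν.real (Set.Ioi τ) ≤ 1 := measureReal_le_one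
    -- Below `τ` the maximum's probability is bounded by `1`, and accepting any value at all
    -- suffices.
    calc _ ≤ ENNReal.ofReal (1 - Real.exp (-ζ)) * 1 := by gcongr; exact prob_le_one
      _ ≤ ENNReal.ofReal (1 - (1 - ν.real (Set.Ioi τ)) ^ n) := by
        rw [mul_one]
        refine ENNReal.ofReal_le_ofReal (sub_le_sub_left ?_ 1)
        rcases le_total ζ n with h | h
        · rw [min_eq_left h] at hτ
          calc (1 - ν.real (Set.Ioi τ)) ^ n ≤ Real.exp (-ν.real (Set.Ioi τ)) ^ n :=
                pow_le_pow_left₀ (sub_nonneg.2 hp1) (Real.one_sub_le_exp_neg _) n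
            _ = Real.exp (-ζ) := by rw [← Real.exp_nat_mul, ← hτ, mul_neg]
        · rw [min_eq_right h] at hτ
          have hp : ν.real (Set.Ioi τ) = 1 := mul_left_cancel₀ hn.ne' (by rw [hτ, mul_one])
          rw [hp, sub_self, zero_pow (NeZero.ne n)]
          exact (Real.exp_pos _).le
      _ = Measure.pi (fun _ : Fin n => ν) {x | τ < ⨆ i, x i} := (pi_lt_iSup ν n τ).symm
      _ ≤ _ := by
        refine measure_mono fun x (hx : τ < _) => ?_
        obtain ⟨i, hi⟩ := lt_iSup_fin_iff.1 hx
        exact hv.trans (lt_reward_of_exists_lt k ⟨x i, List.mem_ofFn.2 ⟨i, rfl⟩, hi⟩)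

/-! ### Transfer to random variables. -/

section IID

variable {Ω : Type*} [MeasurableSpace Ω] {μ : Measure Ω} {n : ℕ} {X : Fin n → Ω → ℝ}

lemma IsContinuousIID.nullSingletonClass_map (hX : IsContinuousIID X μ) (i : Fin n) :
    NullSingletonClass (μ.map (X i)) :=
  ⟨fun x => by
    rw [Measure.map_apply (hX.measurable i) (measurableSet_singleton x)]
    exact hX.noPointMass i x⟩

lemma IsContinuousIID.map_eq_pi [IsProbabilityMeasure μ] (hX : IsContinuousIID X μ) (i : Fin n) :
    μ.map (fun ω j => X j ω) = Measure.pi fun _ => μ.map (X i) := by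
  rw [hX.indep.map_fun_eq_pi_map fun j => (hX.measurable j).aemeasurable]
  congr 1
  ext1 j
  exact (hX.ident j i).map_eq

lemma IsContinuousIID.isInitialThreshold_iff (hX : IsContinuousIID X μ) (i : Fin n) (ζ τ : ℝ) :
    IsInitialThreshold X μ ζ τ ↔ n * (μ.map (X i)).real (Set.Ioi τ) = min ζ n := by
  have := hX.nullSingletonClass_map i
  have h : ∀ j, μ.real {ω | τ ≤ X j ω} = (μ.map (X i)).real (Set.Ioi τ) := fun j => by
    rw [measureReal_congr Ioi_ae_eq_Ici, ← (hX.ident j i).map_eq,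
      map_measureReal_apply (hX.measurable j) measurableSet_Ici]
    rfl
  simp [IsInitialThreshold, h]

lemma IsContinuousIID.exists_isInitialThreshold [IsProbabilityMeasure μ]
    (hX : IsContinuousIID X μ) (i : Fin n) {ζ : ℝ} (hζ : 0 < ζ) :
    ∃ τ, IsInitialThreshold X μ ζ τ := by
  have := hX.nullSingletonClass_map i
  have := Measure.isProbabilityMeasure_map (hX.measurable i).aemeasurable (μ := μ)
  have hn : (0 : ℝ) < n := by exact_mod_cast i.pos
  rcases le_or_gt (n : ℝ) ζ with h | h
  · refine ⟨0, ?_⟩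
    have h1 : ∀ j, μ.real {ω | 0 ≤ X j ω} = 1 := fun j => by
      rw [measureReal_congr (t := Set.univ) (Filter.eventuallyEq_univ.2 (hX.nonneg j)),
        probReal_univ]
    simp [IsInitialThreshold, h1, h]
  · obtain ⟨τ, hτ⟩ := exists_real_Ioi_eq (μ.map (X i))
      (show ζ / n ∈ Set.Ioo (0 : ℝ) 1 from ⟨by positivity, (div_lt_one hn).2 h⟩)
    refine ⟨τ, (hX.isInitialThreshold_iff i ζ τ).2 ?_⟩
    rw [hτ, min_eq_left h.le, mul_div_cancel₀ _ hn.ne']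

lemma IsContinuousIID.isCompetitive [IsProbabilityMeasure μ] (hX : IsContinuousIID X μ)
    (i : Fin n) {k : ℕ} {ζ τ : ℝ} (hζ : IsZeta (k + 1) ζ) (hτ : IsInitialThreshold X μ ζ τ) :
    IsCompetitive (k + 1) τ X μ (1 - Real.exp (-ζ)) := by
  have : NeZero n := ⟨i.pos.ne'⟩
  have := hX.nullSingletonClass_map i
  have := Measure.isProbabilityMeasure_map (hX.measurable i).aemeasurable (μ := μ)
  have hXm : Measurable fun ω j => X j ω := measurable_pi_lambda _ hX.measurable
  have hsup : Measurable fun x : Fin n → ℝ => ⨆ j, x j := Measurable.iSup fun j => measurable_pi_apply j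
  have hrew : Measurable fun x : Fin n → ℝ => reward (k + 1) τ (List.ofFn x) :=
    (measurable_reward n (k + 1)).comp measurable_prodMk_left
  have hlaw : ∀ {f : (Fin n → ℝ) → ℝ}, Measurable f → ∀ t, μ {ω | t < f fun j => X j ω} =
      Measure.pi (fun _ => μ.map (X i)) {x | t < f x} := fun hf t => by
    rw [← hX.map_eq_pi i, Measure.map_apply hXm (measurableSet_lt measurable_const hf)]
    rfl
  unfold IsCompetitive
  -- Layer cake formula on both sides.
  rw [lintegral_eq_lintegral_meas_lt (f := fun ω => ⨆ j, X j ω) μ (by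
      filter_upwards [hX.nonneg i] with ω hω
      exact hω.trans (le_ciSup (f := fun j => X j ω) (Set.finite_range _).bddAbove i))
      (hsup.comp hXm).aemeasurable,
    lintegral_eq_lintegral_meas_lt (f := fun ω => reward (k + 1) τ (List.ofFn fun j => X j ω)) μ
      (ae_of_all _ fun ω => reward_nonneg _ _ _) (hrew.comp hXm).aemeasurable,
    ← lintegral_const_mul' _ _ ENNReal.ofReal_ne_top]
  refine lintegral_mono fun t => ?_
  rw [hlaw hsup, hlaw hrew]
  exact ofReal_mul_pi_lt_iSup_le hζ ((hX.isInitialThreshold_iff i ζ τ).1 hτ) t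

end IID

/-! ### Numerical bounds for `k = 2, 3, 4`. -/

/-- The Taylor bound `Real.exp_bound'` holds on `[0, 1]`, so larger exponents are split as `m * x`.
-/
lemma exp_mul_le_one_of_exp_bound {x c : ℝ} (m n : ℕ) (h0 : 0 ≤ x) (h1 : x ≤ 1) (hn : 0 < n)
    (hc : 0 ≤ 1 - c) (h : (∑ i ∈ Finset.range n, x ^ i / (i.factorial : ℝ) +
      x ^ n * (n + 1) / (n.factorial * n)) ^ m * (1 - c) ≤ 1) :
    Real.exp (m * x) * (1 - c) ≤ 1 := by
  rw [Real.exp_nat_mul]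
  exact (mul_le_mul_of_nonneg_right (pow_le_pow_left₀ (Real.exp_pos _).le
    (Real.exp_bound' h0 h1 hn) m) hc).trans h

lemma le_one_sub_exp_of_isZeta_two {ζ : ℝ} (hζ : IsZeta 2 ζ) :
    (0.8520 : ℝ) ≤ 1 - Real.exp (-ζ) := by
  -- `r = 1.91054` lies just below `-log 0.148`; `r` is chosen likewise for `k = 3, 4`.
  refine le_one_sub_exp_of_isZeta (M := 11) (r := (2 : ℕ) * 0.95527) hζ (by norm_num)
    (by norm_num) (exp_mul_le_one_of_exp_bound 2 10 (by norm_num) (by norm_num) (by norm_num)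
      (by norm_num) ?_) ?_
  · norm_num [Finset.sum_range_succ, Nat.factorial]
  · norm_num [Finset.sum_range_succ, recordProb, Nat.stirlingFirst, Nat.factorial]

lemma le_one_sub_exp_of_isZeta_three {ζ : ℝ} (hζ : IsZeta 3 ζ) :
    (0.9463 : ℝ) ≤ 1 - Real.exp (-ζ) := by
  refine le_one_sub_exp_of_isZeta (M := 14) (r := (4 : ℕ) * 0.73108) hζ (by norm_num)
    (by norm_num) (exp_mul_le_one_of_exp_bound 4 10 (by norm_num) (by norm_num) (by norm_num)
      (by norm_num) ?_) ?_
  · norm_num [Finset.sum_range_succ, Nat.factorial]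
  · norm_num [Finset.sum_range_succ, recordProb, Nat.stirlingFirst, Nat.factorial]

lemma le_one_sub_exp_of_isZeta_four {ζ : ℝ} (hζ : IsZeta 4 ζ) :
    (0.9816 : ℝ) ≤ 1 - Real.exp (-ζ) := by
  refine le_one_sub_exp_of_isZeta (M := 14) (r := (5 : ℕ) * 0.799) hζ (by norm_num)
    (by norm_num) (exp_mul_le_one_of_exp_bound 5 10 (by norm_num) (by norm_num) (by norm_num)
      (by norm_num) ?_) ?_
  · norm_num [Finset.sum_range_succ, Nat.factorial]
  · norm_num [Finset.sum_range_succ, recordProb, Nat.stirlingFirst, Nat.factorial]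

end TopOneOfK

theorem mainTheorem4 :
    (∀ k : ℕ, 2 ≤ k → ∃! ζ : ℝ, TopOneOfK.IsZeta k ζ) ∧
    (∀ (k : ℕ) (ζ : ℝ), 2 ≤ k → TopOneOfK.IsZeta k ζ →
      ∀ (Ω : Type*) [MeasurableSpace Ω] (μ : Measure Ω) [IsProbabilityMeasure μ]
        (n : ℕ) (X : Fin n → Ω → ℝ), 1 ≤ n → TopOneOfK.IsContinuousIID X μ →
        (∃ τ : ℝ, TopOneOfK.IsInitialThreshold X μ ζ τ) ∧
        ∀ τ : ℝ, TopOneOfK.IsInitialThreshold X μ ζ τ →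
          TopOneOfK.IsCompetitive k τ X μ (1 - Real.exp (-ζ))) ∧
    (∀ ζ : ℝ, TopOneOfK.IsZeta 2 ζ → (0.8520 : ℝ) ≤ 1 - Real.exp (-ζ)) ∧
    (∀ ζ : ℝ, TopOneOfK.IsZeta 3 ζ → (0.9463 : ℝ) ≤ 1 - Real.exp (-ζ)) ∧
    (∀ ζ : ℝ, TopOneOfK.IsZeta 4 ζ → (0.9816 : ℝ) ≤ 1 - Real.exp (-ζ)) := by
  refine ⟨fun k hk => TopOneOfK.existsUnique_isZeta (by omega), ?_,
    fun ζ => TopOneOfK.le_one_sub_exp_of_isZeta_two,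
    fun ζ => TopOneOfK.le_one_sub_exp_of_isZeta_three,
    fun ζ => TopOneOfK.le_one_sub_exp_of_isZeta_four⟩
  intro k ζ hk hζ Ω _ μ _ n X hn hX
  obtain ⟨l, rfl⟩ : ∃ l, k = l + 1 := ⟨k - 1, by omega⟩
  have i : Fin n := ⟨0, hn⟩
  exact ⟨hX.exists_isInitialThreshold i hζ.1, fun τ hτ => hX.isCompetitive i hζ hτ⟩
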